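/- Let $z$ be a complex number with $\operatorname{Re} z < 0$ and let $\alpha$ be a real number with $|\operatorname{Im} z| < \alpha$. Define $$J_\alpha(z) = \frac{\alpha}{2\pi}\int_{-1}^{1} \frac{e^{i\alpha x}}{i\alpha x - z}\,dx, \qquad g_\alpha(z,x) = \frac{\alpha}{2\pi}\,\frac{e^{i\alpha x}}{i\alpha x - z},$$ and, for a positive integer $N$, let $$\tilde J_{\alpha,N}(z) = \sum_{i=1}^{N} w_i\, g_\alpha(z,t_i)$$ be the $N$-point Gauss--Legendre approximation of $J_\alpha(z)$, where $t_1,\dots,t_N$ are the zeros of the Legendre polynomial of degree $N$ on $[-1,1]$ and $w_i = \int_{-1}^{1} \prod_{j\ne i}\frac{x-t_j}{t_i-t_j}\,dx$ are the corresponding weights. Let $\delta$ be a real number with $0 < \delta < |\operatorname{Re} z|/\alpha$ and define $$\rho = \frac{|\operatorname{Re} z|}{\alpha} - \delta + \sqrt{\Big(\frac{|\operatorname{Re} z|}{\alpha}-\delta\Big)^2+1}.$$ Then, for every integer $N \ge 2$, $$|J_\alpha(z) - \tilde J_{\alpha,N}(z)| \le \frac{32\, e^{|\operatorname{Re} z|}}{15\pi\delta}\cdot\frac{\rho^{-2(N-1)}}{\rho^2-1}.$$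 -/

import Mathlib

open Polynomial in
/-- The Legendre polynomial of degree `n` on `[-1, 1]`, normalised by `P_n(1) = 1`
(Rodrigues' formula `P_n = (2 ^ n * n!)⁻¹ * d^n/dX^n (X ^ 2 - 1) ^ n`). -/
noncomputable def legendrePoly (n : ℕ) : ℝ[X] :=
  C ((2 ^ n * (Nat.factorial n : ℝ))⁻¹) * derivative^[n] ((X ^ 2 - 1) ^ n)

/-- The nodes of the `N`-point Gauss–Legendre formula: the zeros of the Legendre polynomial of
degree `N` (which are all real and simple). -/
noncomputable def gaussLegendreNodes (N : ℕ) : Finset ℝ :=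
  (legendrePoly N).roots.toFinset

/-- The weight of the `N`-point Gauss–Legendre formula at the node `t`: the integral over
`[-1, 1]` of the Lagrange basis polynomial which is `1` at `t` and `0` at all other nodes. -/
noncomputable def gaussLegendreWeight (N : ℕ) (t : ℝ) : ℝ :=
  ∫ x in (-1 : ℝ)..1, (Lagrange.basis (gaussLegendreNodes N) id t).eval x

/-- The `N`-point Gauss–Legendre approximation of `∫ x in -1..1, g x`. -/
noncomputable def gaussLegendreQuadrature (N : ℕ) (g : ℝ → ℂ) : ℂ :=
  ∑ t ∈ gaussLegendreNodes N, (gaussLegendreWeight N t : ℂ) * g t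

/-- The integrand `g_α(z, x) = α / (2π) * e^{iαx} / (iαx - z)`. -/
noncomputable def gFun (α : ℝ) (z : ℂ) (x : ℝ) : ℂ :=
  (α / (2 * Real.pi) : ℂ) *
    (Complex.exp (Complex.I * α * x) / (Complex.I * α * x - z))

/-- `J_α(z) = α / (2π) * ∫_{-1}^{1} e^{iαx} / (iαx - z) dx`. -/
noncomputable def JInt (α : ℝ) (z : ℂ) : ℂ :=
  (α / (2 * Real.pi) : ℂ) *
    ∫ x in (-1 : ℝ)..1, Complex.exp (Complex.I * α * x) / (Complex.I * α * x - z)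

/-- The `N`-point Gauss–Legendre approximation of `J_α(z)`. -/
noncomputable def JApprox (α : ℝ) (N : ℕ) (z : ℂ) : ℂ :=
  gaussLegendreQuadrature N (gFun α z)

/-- `ρ_{z,α,δ} = |Re z|/α - δ + √((|Re z|/α - δ)² + 1)`. -/
noncomputable def rhoParam (z : ℂ) (α δ : ℝ) : ℝ :=
  |z.re| / α - δ + Real.sqrt ((|z.re| / α - δ) ^ 2 + 1)

/-!
The bound is the classical estimate for Gauss quadrature of an integrand analytic on a Bernstein
ellipse. If `f` is analytic on the closed ellipse with parameter `ρ > 1` and bounded by `M` on the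
boundary, its Chebyshev expansion `f = ∑_{n ∈ ℤ} c_n T_n` on `[-1, 1]` has
`|c_n| ≤ M ρ ^ (-|n|)`: the `c_n` are the Fourier coefficients of `θ ↦ f (cos θ)`, that is,
integrals over the unit circle after the Joukowski substitution, and the contour can be moved out to `‖w‖ = ρ`
(`norm_chebyshevCoeff_le`, `hasSum_chebyshevCoeff`).

The quadrature error acts termwise on this expansion. It kills `T_n` for `n < 2 N`, by exactness of
the formula (`sum_gaussLegendreWeight_mul_eval`, which rests on the orthogonality of the Legendre
polynomials), and for odd `n`, by symmetry of nodes and weights. For even `n ≥ 4` the error of `T_n`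
is at most `2 / 15 + 2 = 32 / 15`, because the weights are nonnegative with sum `2`
(`abs_gaussLegendreError_chebyshevT_le`). Summing the geometric series over the even `n ≥ 2 N`, with
the terms `n` and `-n` combined, gives `64 / 15 * M * ρ ^ (-2 N) / (1 - ρ ^ (-2))`
(`norm_integral_sub_gaussLegendreQuadrature_le`).

For `g_α(z, ·)` the parameter `ρ` is the one whose ellipse has semi-minor axis `|Re z| / α - δ`. The
pole of the integrand has imaginary part `|Re z| / α`, so on the ellipse the denominator has norm at
least `α δ`, the exponential has norm at most `exp |Re z|`, and `M = exp |Re z| / (2 π δ)` works.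
-/

open Polynomial

/-! ### The Gauss–Legendre formula -/

/-- Integration by parts moves derivatives from `(X ^ 2 - 1) ^ n` to `q`; the boundary terms vanish
because the first `n - 1` derivatives of `(X ^ 2 - 1) ^ n` are still divisible by `X ^ 2 - 1`. -/
theorem integral_mul_iterate_derivative_eq_zero (n : ℕ) :
    ∀ k ≤ n, ∀ q : ℝ[X], q.degree < k →
      ∫ x in (-1 : ℝ)..1, (q * derivative^[k] ((X ^ 2 - 1) ^ n)).eval x = 0 := by
  intro k
  induction k with
  | zero =>
    intro _ q hq
    have : q = 0 := by
      rw [← degree_eq_bot]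
      exact Nat.WithBot.lt_zero_iff.mp (by simpa using hq)
    simp [this]
  | succ k ih =>
    intro hk q hq
    set g : ℝ[X] := derivative^[k] ((X ^ 2 - 1) ^ n) with hg
    have hdvd : (X ^ 2 - 1 : ℝ[X]) ∣ g :=
      (dvd_pow_self _ (by omega : n - k ≠ 0)).trans
        (pow_sub_dvd_iterate_derivative_of_pow_dvd k dvd_rfl)
    obtain ⟨h, hh⟩ := hdvd
    have h1 : g.eval 1 = 0 := by rw [hh]; simp
    have h2 : g.eval (-1) = 0 := by rw [hh]; simp
    have hparts := intervalIntegral.integral_mul_deriv_eq_deriv_mul (a := (-1 : ℝ)) (b := 1)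
      (u := fun x => q.eval x) (v := fun x => g.eval x)
      (u' := fun x => (derivative q).eval x) (v' := fun x => (derivative g).eval x)
      (fun x _ => q.hasDerivAt x) (fun x _ => g.hasDerivAt x)
      ((derivative q).continuous.intervalIntegrable _ _)
      ((derivative g).continuous.intervalIntegrable _ _)
    have hq' : (derivative q).degree < k := by
      by_cases h0 : q = 0
      · simp [h0]
      · have h3 := degree_derivative_lt h0
        by_cases hd : derivative q = 0
        · simp [hd]
        · rw [degree_eq_natDegree h0] at hq h3
          rw [degree_eq_natDegree hd] at h3 ⊢
          have := Nat.cast_lt.mp hq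
          have := Nat.cast_lt.mp h3
          exact Nat.cast_lt.mpr (by omega)
    have := ih (by omega) _ hq'
    simp only [eval_mul] at this
    rw [Function.iterate_succ_apply', ← hg]
    simp only [eval_mul]
    rw [hparts, this, h1, h2]
    simp

theorem integral_mul_legendrePoly_eq_zero {n : ℕ} {q : ℝ[X]} (hq : q.degree < n) :
    ∫ x in (-1 : ℝ)..1, (q * legendrePoly n).eval x = 0 := by
  have := integral_mul_iterate_derivative_eq_zero n n le_rfl q hq
  have h : ∀ x : ℝ, (q * legendrePoly n).eval x = (2 ^ n * (Nat.factorial n : ℝ))⁻¹ *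
      (q * derivative^[n] ((X ^ 2 - 1) ^ n)).eval x := by
    intro x; simp only [legendrePoly, eval_mul, eval_C]; ring
  simp_rw [h]
  rw [intervalIntegral.integral_const_mul, this, mul_zero]

theorem card_roots_X_sq_sub_one_pow (n : ℕ) : ((X ^ 2 - 1 : ℝ[X]) ^ n).roots.card = 2 * n := by
  have : (X ^ 2 - 1 : ℝ[X]) = (X - C 1) * (X - C (-1)) := by simp; ring
  rw [roots_pow, this, roots_mul (mul_ne_zero (X_sub_C_ne_zero _) (X_sub_C_ne_zero _)),
    roots_X_sub_C, roots_X_sub_C]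
  simp; ring

theorem natDegree_legendrePoly_le (n : ℕ) : (legendrePoly n).natDegree ≤ n := by
  have h : ((X ^ 2 - 1 : ℝ[X]) ^ n).natDegree = 2 * n := by
    rw [natDegree_pow, show (X ^ 2 - 1 : ℝ[X]) = X ^ 2 - C 1 by simp, natDegree_X_pow_sub_C]; ring
  have := natDegree_iterate_derivative ((X ^ 2 - 1 : ℝ[X]) ^ n) n
  rw [legendrePoly, natDegree_C_mul (by positivity)]
  omega

/-- By Rolle's theorem each differentiation loses at most one real root. -/
theorem card_roots_legendrePoly (n : ℕ) : (legendrePoly n).roots.card = n := by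
  refine le_antisymm ((card_roots' _).trans (natDegree_legendrePoly_le n)) ?_
  have h : ∀ k, 2 * n ≤ (derivative^[k] ((X ^ 2 - 1 : ℝ[X]) ^ n)).roots.card + k := by
    intro k
    induction k with
    | zero => simp only [Function.iterate_zero, id, card_roots_X_sq_sub_one_pow, add_zero, le_refl]
    | succ k ih =>
      have := card_roots_le_derivative (derivative^[k] ((X ^ 2 - 1 : ℝ[X]) ^ n))
      rw [Function.iterate_succ_apply']
      omega
  have := h n
  rw [legendrePoly, roots_C_mul _ (by positivity)]
  omega

theorem natDegree_legendrePoly (n : ℕ) : (legendrePoly n).natDegree = n :=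
  (natDegree_legendrePoly_le n).antisymm
    ((card_roots_legendrePoly n).symm.le.trans (card_roots' _))

theorem legendrePoly_ne_zero (n : ℕ) : legendrePoly n ≠ 0 := by
  rcases Nat.eq_zero_or_pos n with rfl | hn
  · simp [legendrePoly]
  · exact ne_zero_of_natDegree_gt (n := 0) (by rwa [natDegree_legendrePoly])

theorem integral_eval_pos {p : ℝ[X]} (hp : p ≠ 0) (h : ∀ x ∈ Set.Icc (-1 : ℝ) 1, 0 ≤ p.eval x) :
    0 < ∫ x in (-1 : ℝ)..1, p.eval x := by
  refine intervalIntegral.integral_pos (by norm_num) p.continuous.continuousOn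
    (fun x hx => h x ⟨hx.1.le, hx.2⟩) ?_
  by_contra! hc
  refine hp (eq_zero_of_infinite_isRoot p ?_)
  exact (Set.Icc_infinite (by norm_num : (-1 : ℝ) < 1)).mono
    fun x hx => le_antisymm (hc x hx) (h x hx)

/-- If `P_n = m * q` with `deg q < n`, then orthogonality to `q` forbids `m` from having constant
sign on `[-1, 1]`. -/
theorem legendrePoly_ne_mul {n : ℕ} {m q : ℝ[X]} (hm : 0 < m.natDegree)
    (h : legendrePoly n = m * q) : ¬ ∀ x ∈ Set.Icc (-1 : ℝ) 1, 0 ≤ m.eval x := by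
  intro hpos
  have hne := legendrePoly_ne_zero n
  rw [h] at hne
  have hm0 := left_ne_zero_of_mul hne
  have hq0 := right_ne_zero_of_mul hne
  have hdeg := natDegree_legendrePoly n
  rw [h, natDegree_mul hm0 hq0] at hdeg
  have h0 : ∫ x in (-1 : ℝ)..1, (q * legendrePoly n).eval x = 0 := by
    apply integral_mul_legendrePoly_eq_zero
    rw [degree_eq_natDegree hq0]
    exact Nat.cast_lt.mpr (by omega)
  rw [h] at h0
  refine (integral_eval_pos (mul_ne_zero hq0 hne) fun x hx => ?_).ne' h0
  have : (q * (m * q)).eval x = m.eval x * (q.eval x) ^ 2 := by simp only [eval_mul]; ring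
  rw [this]
  exact mul_nonneg (hpos x hx) (sq_nonneg _)

theorem mem_gaussLegendreNodes {N : ℕ} {t : ℝ} :
    t ∈ gaussLegendreNodes N ↔ (legendrePoly N).IsRoot t := by
  simp [gaussLegendreNodes, legendrePoly_ne_zero]

theorem nodup_roots_legendrePoly (n : ℕ) : (legendrePoly n).roots.Nodup := by
  rw [Multiset.nodup_iff_count_le_one]
  intro t
  by_contra! hc
  rw [count_roots] at hc
  obtain ⟨q, hq⟩ := (le_rootMultiplicity_iff (legendrePoly_ne_zero n)).mp hc
  refine legendrePoly_ne_mul (m := (X - C t) ^ 2) (by simp) hq fun x _ => ?_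
  simp only [eval_pow]; positivity

theorem card_gaussLegendreNodes (N : ℕ) : (gaussLegendreNodes N).card = N := by
  rw [gaussLegendreNodes, Multiset.toFinset_card_of_nodup (nodup_roots_legendrePoly N),
    card_roots_legendrePoly]

theorem gaussLegendreNodes_subset_Icc {N : ℕ} {t : ℝ} (ht : t ∈ gaussLegendreNodes N) :
    t ∈ Set.Icc (-1 : ℝ) 1 := by
  obtain ⟨q, hq⟩ := dvd_iff_isRoot.mpr (mem_gaussLegendreNodes.mp ht)
  constructor
  · by_contra! hc
    refine legendrePoly_ne_mul (m := X - C t) (by simp) hq fun x hx => ?_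
    simp only [eval_sub, eval_X, eval_C]; linarith [hx.1]
  · by_contra! hc
    refine legendrePoly_ne_mul (m := -(X - C t)) (q := -q) (by rw [natDegree_neg]; simp)
      (by rw [hq]; ring) fun x hx => ?_
    simp only [eval_neg, eval_sub, eval_X, eval_C]; linarith [hx.2]

/-- The `k`-th derivative of an even polynomial has the parity of `k`. -/
theorem iterate_derivative_comp_neg_X (p : ℝ[X]) (hp : p.comp (-X) = p) (k : ℕ) :
    (derivative^[k] p).comp (-X) = (-1) ^ k * derivative^[k] p := by
  induction k with
  | zero => simp [hp]
  | succ k ih =>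
    have h := congrArg derivative ih
    rw [derivative_comp] at h
    rw [Function.iterate_succ_apply']
    have h2 : derivative ((-1 : ℝ[X]) ^ k * derivative^[k] p) =
        (-1) ^ k * derivative (derivative^[k] p) := by
      rw [show ((-1 : ℝ[X]) ^ k) = C ((-1) ^ k) by simp, derivative_C_mul]
    rw [h2] at h
    simp only [derivative_neg, derivative_X] at h
    linear_combination -h

theorem neg_mem_gaussLegendreNodes {N : ℕ} {t : ℝ} (ht : t ∈ gaussLegendreNodes N) :
    -t ∈ gaussLegendreNodes N := by
  rw [mem_gaussLegendreNodes] at ht ⊢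
  have h := congrArg (eval t)
    (iterate_derivative_comp_neg_X ((X ^ 2 - 1) ^ N) (by simp) N)
  simp only [IsRoot, legendrePoly, eval_mul, eval_C, eval_comp, eval_neg, eval_X, eval_pow,
    eval_one] at h ht ⊢
  rw [h]
  linear_combination (-1) ^ N * ht

/-- The formula is exact in degrees below `2 * N`: divide by `P_N`; the multiple of `P_N`
contributes nothing to either side, and the remainder equals its Lagrange interpolant. -/
theorem sum_gaussLegendreWeight_mul_eval {N : ℕ} {p : ℝ[X]} (hp : p.natDegree < 2 * N) :
    ∑ t ∈ gaussLegendreNodes N, gaussLegendreWeight N t * p.eval t =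
      ∫ x in (-1 : ℝ)..1, p.eval x := by
  set P := legendrePoly N with hP
  have hP0 : P ≠ 0 := legendrePoly_ne_zero N
  have hPd : P.natDegree = N := natDegree_legendrePoly N
  have hmod := EuclideanDomain.div_add_mod p P
  have hr : (p % P).degree < N := by
    have := degree_mod_lt p hP0
    rwa [degree_eq_natDegree hP0, hPd] at this
  have hq : (p / P).degree < N := by
    by_cases h0 : p / P = 0
    · simp [h0]
    · have hle : P.degree ≤ p.degree := by
        by_contra! hlt
        exact h0 ((Polynomial.div_eq_zero_iff hP0).mpr hlt)
      have hadd := degree_add_div hP0 hle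
      have hp0 : p ≠ 0 := by rintro rfl; simp at h0
      rw [degree_eq_natDegree hP0, degree_eq_natDegree h0, degree_eq_natDegree hp0, hPd] at hadd
      rw [degree_eq_natDegree h0]
      have : N + (p / P).natDegree = p.natDegree := by exact_mod_cast hadd
      exact Nat.cast_lt.mpr (by omega)
  have hint : ∫ x in (-1 : ℝ)..1, p.eval x = ∫ x in (-1 : ℝ)..1, (p % P).eval x := by
    have h1 := integral_mul_legendrePoly_eq_zero hq
    have h2 : ∀ x : ℝ, p.eval x = ((p / P) * P).eval x + (p % P).eval x := by
      intro x; rw [← eval_add, mul_comm, hmod]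
    simp_rw [h2]
    rw [intervalIntegral.integral_add (Polynomial.continuous _ |>.intervalIntegrable _ _)
      (Polynomial.continuous _ |>.intervalIntegrable _ _), h1, zero_add]
  have hnode : ∀ t ∈ gaussLegendreNodes N, p.eval t = (p % P).eval t := by
    intro t ht
    have : P.eval t = 0 := mem_gaussLegendreNodes.mp ht
    conv_lhs => rw [← hmod]
    simp [this]
  have hlag : p % P = Lagrange.interpolate (gaussLegendreNodes N) id
      (fun t => (p % P).eval t) :=
    Lagrange.eq_interpolate Function.injective_id.injOn (by rwa [card_gaussLegendreNodes])
  rw [hint]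
  conv_rhs => rw [hlag]
  simp only [Lagrange.interpolate_apply, eval_finsetSum, eval_mul, eval_C]
  rw [intervalIntegral.integral_finsetSum
    (fun t _ => (Continuous.intervalIntegrable (by fun_prop) _ _))]
  refine Finset.sum_congr rfl fun t ht => ?_
  rw [intervalIntegral.integral_const_mul, hnode t ht, gaussLegendreWeight, mul_comm]

theorem sum_mul_eval_basis {N : ℕ} {t : ℝ} (ht : t ∈ gaussLegendreNodes N) (w : ℝ → ℝ) (k : ℕ)
    (hk : k ≠ 0) :
    ∑ s ∈ gaussLegendreNodes N,
      w s * (Lagrange.basis (gaussLegendreNodes N) id t).eval s ^ k = w t := by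
  rw [Finset.sum_eq_single_of_mem t ht]
  · have := Lagrange.eval_basis_self (v := id) Function.injective_id.injOn ht
    simp only [id] at this
    rw [this]; simp
  · intro s hs hst
    have := Lagrange.eval_basis_of_ne (v := id) (i := t) hst.symm hs
    simp only [id] at this
    rw [this]; simp [hk]

theorem natDegree_basis_gaussLegendreNodes {N : ℕ} {t : ℝ} (ht : t ∈ gaussLegendreNodes N) :
    (Lagrange.basis (gaussLegendreNodes N) id t).natDegree = N - 1 := by
  rw [Lagrange.natDegree_basis Function.injective_id.injOn ht, card_gaussLegendreNodes]

/-- The weight at `t` is the integral of the square of the Lagrange basis polynomial at `t`. -/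
theorem gaussLegendreWeight_nonneg {N : ℕ} {t : ℝ} (ht : t ∈ gaussLegendreNodes N) :
    0 ≤ gaussLegendreWeight N t := by
  have hN : 0 < N := by
    have := Finset.card_pos.mpr ⟨t, ht⟩
    rwa [card_gaussLegendreNodes] at this
  have h := sum_gaussLegendreWeight_mul_eval (N := N)
    (p := Lagrange.basis (gaussLegendreNodes N) id t ^ 2)
    (by rw [natDegree_pow, natDegree_basis_gaussLegendreNodes ht]; omega)
  simp only [eval_pow] at h
  rw [sum_mul_eval_basis ht _ 2 two_ne_zero] at h
  rw [h]
  exact intervalIntegral.integral_nonneg (by norm_num) fun x _ => sq_nonneg _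

theorem sum_gaussLegendreWeight {N : ℕ} (hN : 0 < N) :
    ∑ t ∈ gaussLegendreNodes N, gaussLegendreWeight N t = 2 := by
  have h := sum_gaussLegendreWeight_mul_eval (N := N) (p := 1) (by simpa using hN)
  simp only [eval_one, mul_one] at h
  rw [h]; norm_num

/-- Both weights equal the integral of `L_t(x)`, or of `L_t(-x)`, which exactness evaluates. -/
theorem gaussLegendreWeight_neg {N : ℕ} {t : ℝ} (ht : t ∈ gaussLegendreNodes N) :
    gaussLegendreWeight N (-t) = gaussLegendreWeight N t := by
  have hN : 0 < N := by
    have := Finset.card_pos.mpr ⟨t, ht⟩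
    rwa [card_gaussLegendreNodes] at this
  have h := sum_gaussLegendreWeight_mul_eval (N := N)
    (p := (Lagrange.basis (gaussLegendreNodes N) id t).comp (-X))
    (by rw [natDegree_comp, natDegree_basis_gaussLegendreNodes ht, natDegree_neg]; simp; omega)
  simp only [eval_comp, eval_neg, eval_X] at h
  rw [intervalIntegral.integral_comp_neg
    (fun x => (Lagrange.basis (gaussLegendreNodes N) id t).eval x), neg_neg] at h
  have h2 : ∑ s ∈ gaussLegendreNodes N, gaussLegendreWeight N s *
      (Lagrange.basis (gaussLegendreNodes N) id t).eval (-s) =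
      ∑ s ∈ gaussLegendreNodes N, gaussLegendreWeight N (-s) *
      (Lagrange.basis (gaussLegendreNodes N) id t).eval s ^ 1 :=
    Finset.sum_nbij' (fun s => -s) (fun s => -s) (fun s => neg_mem_gaussLegendreNodes)
      (fun s => neg_mem_gaussLegendreNodes) (by simp) (by simp) (by simp)
  rw [h2, sum_mul_eval_basis ht (fun s => gaussLegendreWeight N (-s)) 1 one_ne_zero] at h
  exact h

theorem sum_gaussLegendreWeight_mul_of_odd (N : ℕ) {f : ℝ → ℝ} (hf : ∀ x, f (-x) = -f x) :
    ∑ t ∈ gaussLegendreNodes N, gaussLegendreWeight N t * f t = 0 := by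
  have h : ∑ t ∈ gaussLegendreNodes N, gaussLegendreWeight N t * f t =
      ∑ t ∈ gaussLegendreNodes N, -(gaussLegendreWeight N t * f t) :=
    Finset.sum_nbij' (fun s => -s) (fun s => -s) (fun s => neg_mem_gaussLegendreNodes)
      (fun s => neg_mem_gaussLegendreNodes) (by simp) (by simp)
      (fun t ht => by rw [gaussLegendreWeight_neg ht, hf]; ring)
  rw [Finset.sum_neg_distrib] at h
  linarith

/-! ### The quadrature error on Chebyshev polynomials -/

/-- The error of the `N`-point Gauss–Legendre formula on a real polynomial. -/
noncomputable def gaussLegendreError (N : ℕ) (p : ℝ[X]) : ℝ :=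
  (∫ x in (-1 : ℝ)..1, p.eval x) -
    ∑ t ∈ gaussLegendreNodes N, gaussLegendreWeight N t * p.eval t

/-- An antiderivative of `T_n` is `T_{n+1} / (2 (n + 1)) - T_{n-1} / (2 (n - 1))`. -/
theorem integral_chebyshevT_of_even {n : ℕ} (hn : 2 ≤ n) (he : Even n) :
    ∫ x in (-1 : ℝ)..1, (Chebyshev.T ℝ n).eval x = -(2 / ((n : ℝ) ^ 2 - 1)) := by
  have hn' : (2 : ℝ) ≤ n := by exact_mod_cast hn
  have h1 : (n : ℝ) + 1 ≠ 0 := by linarith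
  have h2 : (n : ℝ) - 1 ≠ 0 := by linarith
  set A : ℝ[X] := C (1 / (2 * ((n : ℝ) + 1))) * Chebyshev.T ℝ (n + 1) -
    C (1 / (2 * ((n : ℝ) - 1))) * Chebyshev.T ℝ (n - 1) with hA
  have hd : ∀ x : ℝ, (derivative A).eval x = (Chebyshev.T ℝ n).eval x := by
    intro x
    have hU := congrArg (eval x) (Chebyshev.two_mul_T_eq_U_sub_U ℝ ((n : ℤ) - 2))
    simp only [sub_add_cancel, eval_mul, eval_sub, eval_ofNat] at hU
    simp only [hA, derivative_sub, derivative_C_mul, Chebyshev.T_derivative_eq_U, eval_sub,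
      eval_mul, eval_C, eval_intCast, add_sub_cancel_right]
    rw [show (n : ℤ) - 1 - 1 = n - 2 by ring]
    push_cast
    field_simp
    linarith
  have hodd : Odd ((n : ℤ) + 1) := by
    have : Even (n : ℤ) := by exact_mod_cast he
    exact this.add_one
  have hodd' : Odd ((n : ℤ) - 1) := by
    have : Even (n : ℤ) := by exact_mod_cast he
    exact this.sub_odd odd_one
  simp_rw [← hd]
  rw [intervalIntegral.integral_eq_sub_of_hasDerivAt (fun x _ => A.hasDerivAt x)
    ((derivative A).continuous.intervalIntegrable _ _)]
  have h3 : (n : ℝ) ^ 2 - 1 ≠ 0 := by nlinarith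
  simp only [hA, eval_sub, eval_mul, eval_C, Chebyshev.T_eval_one, Chebyshev.T_eval_neg_one,
    Int.negOnePow_odd _ hodd, Int.negOnePow_odd _ hodd']
  push_cast
  field_simp
  ring

theorem gaussLegendreError_chebyshevT_of_lt {N n : ℕ} (h : n < 2 * N) :
    gaussLegendreError N (Chebyshev.T ℝ n) = 0 := by
  rw [gaussLegendreError, sum_gaussLegendreWeight_mul_eval (by simpa using h), sub_self]

theorem gaussLegendreError_chebyshevT_of_odd (N : ℕ) {n : ℕ} (hn : Odd n) :
    gaussLegendreError N (Chebyshev.T ℝ n) = 0 := by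
  have hn' : Odd (n : ℤ) := by exact_mod_cast hn
  have hodd : ∀ x : ℝ, (Chebyshev.T ℝ n).eval (-x) = -(Chebyshev.T ℝ n).eval x := by
    intro x
    rw [Chebyshev.T_eval_neg, Int.negOnePow_odd _ hn']; simp
  rw [gaussLegendreError, sum_gaussLegendreWeight_mul_of_odd N hodd, sub_zero]
  have h := intervalIntegral.integral_comp_neg (a := (-1 : ℝ)) (b := 1)
    (fun x => (Chebyshev.T ℝ n).eval x)
  simp only [hodd, neg_neg, intervalIntegral.integral_neg] at h
  linarith

/-- The integral contributes at most `2 / (n ^ 2 - 1) ≤ 2 / 15` and the quadrature sum at most the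
total weight `2`. -/
theorem abs_gaussLegendreError_chebyshevT_le {N n : ℕ} (hN : 0 < N) (hn : 4 ≤ n) (he : Even n) :
    |gaussLegendreError N (Chebyshev.T ℝ n)| ≤ 32 / 15 := by
  have hn' : (4 : ℝ) ≤ n := by exact_mod_cast hn
  have h1 : |∫ x in (-1 : ℝ)..1, (Chebyshev.T ℝ n).eval x| ≤ 2 / 15 := by
    have h15 : (15 : ℝ) ≤ (n : ℝ) ^ 2 - 1 := by nlinarith
    rw [integral_chebyshevT_of_even (by omega) he, abs_neg, abs_of_nonneg (by positivity)]
    gcongr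
  have h2 : |∑ t ∈ gaussLegendreNodes N, gaussLegendreWeight N t * (Chebyshev.T ℝ n).eval t|
      ≤ 2 := by
    rw [← sum_gaussLegendreWeight hN]
    refine (Finset.abs_sum_le_sum_abs _ _).trans (Finset.sum_le_sum fun t ht => ?_)
    rw [abs_mul, abs_of_nonneg (gaussLegendreWeight_nonneg ht)]
    exact mul_le_of_le_one_right (gaussLegendreWeight_nonneg ht)
      (Chebyshev.abs_eval_T_real_le_one n (abs_le.mpr (gaussLegendreNodes_subset_Icc ht)))
  calc _ ≤ _ := abs_sub _ _
    _ ≤ 2 / 15 + 2 := add_le_add h1 h2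
    _ = 32 / 15 := by norm_num

/-! ### Chebyshev expansions on a Bernstein ellipse -/

/-- The Joukowski map `w ↦ (w + w⁻¹) / 2`. It sends the circle `‖w‖ = ρ` onto the boundary of the
Bernstein ellipse with parameter `ρ`, and the unit circle onto `[-1, 1]`. -/
noncomputable def joukowski (w : ℂ) : ℂ := (w + w⁻¹) / 2

theorem joukowski_exp (θ : ℂ) : joukowski (Complex.exp (θ * Complex.I)) = Complex.cos θ := by
  rw [joukowski, Complex.cos, ← Complex.exp_neg, neg_mul]

theorem differentiableAt_joukowski {w : ℂ} (hw : w ≠ 0) : DifferentiableAt ℂ joukowski w := by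
  unfold joukowski
  fun_prop (disch := assumption)

/-- The `n`-th coefficient of the Chebyshev expansion of `f`, indexed by `ℤ`: the `n`-th Fourier
coefficient of `θ ↦ f (cos θ)`. -/
noncomputable def chebyshevCoeff (f : ℂ → ℂ) (n : ℤ) : ℂ :=
  (2 * Real.pi : ℂ)⁻¹ * ∫ θ in (0 : ℝ)..2 * Real.pi,
    Complex.exp (-n * θ * Complex.I) * f (Complex.cos θ)

theorem chebyshevCoeff_neg (f : ℂ → ℂ) (n : ℤ) : chebyshevCoeff f (-n) = chebyshevCoeff f n := by
  rw [chebyshevCoeff, chebyshevCoeff]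
  congr 1
  have h := intervalIntegral.integral_comp_sub_left (a := (0 : ℝ)) (b := 2 * Real.pi)
    (fun θ : ℝ => Complex.exp (-n * θ * Complex.I) * f (Complex.cos θ)) (2 * Real.pi)
  rw [sub_self, sub_zero] at h
  rw [← h]
  refine intervalIntegral.integral_congr fun θ _ => ?_
  have h1 : Complex.exp (-n * ((2 * Real.pi - θ : ℝ) : ℂ) * Complex.I) =
      Complex.exp (n * θ * Complex.I) := by
    rw [Complex.exp_eq_exp_iff_exists_int]
    exact ⟨-n, by push_cast; ring⟩
  have h2 : Complex.cos ((2 * Real.pi - θ : ℝ) : ℂ) = Complex.cos θ := by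
    push_cast; exact Complex.cos_two_pi_sub _
  simp only [h1, h2]
  push_cast
  simp

/-- Writing the coefficient as an integral over the unit circle and moving the contour out to
`‖w‖ = ρ` gains the factor `ρ⁻¹ ^ n`. -/
theorem norm_chebyshevCoeff_natCast_le {f : ℂ → ℂ} {ρ M : ℝ} (hρ : 1 ≤ ρ)
    (hd : ∀ w : ℂ, 1 ≤ ‖w‖ → ‖w‖ ≤ ρ → DifferentiableAt ℂ f (joukowski w))
    (hM : ∀ w : ℂ, ‖w‖ = ρ → ‖f (joukowski w)‖ ≤ M) (n : ℕ) :
    ‖chebyshevCoeff f n‖ ≤ M * ρ⁻¹ ^ n := by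
  have hρ0 : 0 < ρ := by linarith
  have hdiff : ∀ w : ℂ, 1 ≤ ‖w‖ → ‖w‖ ≤ ρ →
      DifferentiableAt ℂ (fun w => f (joukowski w) * (w⁻¹) ^ n) w := by
    intro w h1 h2
    have hw : w ≠ 0 := by rintro rfl; simp at h1; linarith
    exact ((hd w h1 h2).comp w (differentiableAt_joukowski hw)).mul
      ((differentiableAt_inv hw).pow n)
  have hshift := Complex.circleIntegral_sub_center_inv_smul_eq_of_differentiable_on_annulus_off_countable
    (c := 0) one_pos hρ (f := fun w => f (joukowski w) * (w⁻¹) ^ n) Set.countable_empty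
    (fun w hw => by
      have h1 : ‖w‖ ≤ ρ := by simpa using hw.1
      have h2 : 1 ≤ ‖w‖ := by simpa using hw.2
      exact (hdiff w h2 h1).continuousAt.continuousWithinAt)
    (fun w hw => by
      have h1 : ‖w‖ < ρ := by simpa using hw.1.1
      have h2 : 1 < ‖w‖ := by simpa using hw.1.2
      exact hdiff w h2.le h1.le)
  have hunit : chebyshevCoeff f n = (2 * Real.pi * Complex.I)⁻¹ •
      ∮ w in C(0, 1), (w - 0)⁻¹ • (f (joukowski w) * (w⁻¹) ^ n) := by
    rw [chebyshevCoeff, circleIntegral, smul_eq_mul, mul_inv _ Complex.I, mul_assoc,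
      ← intervalIntegral.integral_const_mul Complex.I⁻¹]
    congr 1
    refine intervalIntegral.integral_congr fun θ _ => ?_
    have h1 : Complex.exp (θ * Complex.I) ≠ 0 := Complex.exp_ne_zero _
    have h2 : Complex.exp (-((n : ℤ) : ℂ) * θ * Complex.I) =
        (Complex.exp (θ * Complex.I))⁻¹ ^ n := by
      rw [← Complex.exp_neg, ← Complex.exp_nat_mul]
      congr 1; push_cast; ring
    simp only [deriv_circleMap, circleMap_zero, Complex.ofReal_one, one_mul, sub_zero, smul_eq_mul,
      joukowski_exp, h2]
    field_simp [Complex.I_ne_zero]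
  rw [hunit, ← hshift]
  refine (circleIntegral.norm_two_pi_i_inv_smul_integral_le_of_norm_le_const hρ0.le
    (C := ρ⁻¹ * (M * ρ⁻¹ ^ n)) fun w hw => ?_).trans_eq (by field_simp)
  have hw' : ‖w‖ = ρ := by simpa using hw
  rw [sub_zero, norm_smul, norm_mul, norm_inv, norm_pow, norm_inv, hw']
  gcongr
  exact hM w hw'

theorem norm_chebyshevCoeff_le {f : ℂ → ℂ} {ρ M : ℝ} (hρ : 1 ≤ ρ)
    (hd : ∀ w : ℂ, 1 ≤ ‖w‖ → ‖w‖ ≤ ρ → DifferentiableAt ℂ f (joukowski w))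
    (hM : ∀ w : ℂ, ‖w‖ = ρ → ‖f (joukowski w)‖ ≤ M) (n : ℤ) :
    ‖chebyshevCoeff f n‖ ≤ M * ρ⁻¹ ^ n.natAbs := by
  obtain ⟨k, rfl | rfl⟩ := n.eq_nat_or_neg
  · simpa using norm_chebyshevCoeff_natCast_le hρ hd hM k
  · rw [chebyshevCoeff_neg]
    simpa using norm_chebyshevCoeff_natCast_le hρ hd hM k

theorem summable_chebyshevCoeff {f : ℂ → ℂ} {ρ M : ℝ} (hρ : 1 < ρ)
    (hd : ∀ w : ℂ, 1 ≤ ‖w‖ → ‖w‖ ≤ ρ → DifferentiableAt ℂ f (joukowski w))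
    (hM : ∀ w : ℂ, ‖w‖ = ρ → ‖f (joukowski w)‖ ≤ M) :
    Summable fun n : ℤ => ‖chebyshevCoeff f n‖ := by
  have hgeo : Summable fun n : ℕ => M * ρ⁻¹ ^ n :=
    (summable_geometric_of_lt_one (by positivity) (inv_lt_one_of_one_lt₀ hρ)).mul_left M
  refine Summable.of_nat_of_neg ?_ ?_
  · refine Summable.of_nonneg_of_le (fun _ => norm_nonneg _) (fun n => ?_) hgeo
    simpa using norm_chebyshevCoeff_le hρ.le hd hM n
  · refine Summable.of_nonneg_of_le (fun _ => norm_nonneg _) (fun n => ?_) hgeo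
    simpa using norm_chebyshevCoeff_le hρ.le hd hM (-n)

/-- The Chebyshev expansion, obtained by averaging the Fourier series of `θ ↦ f (cos θ)` at `θ`
and `-θ`. -/
theorem hasSum_chebyshevCoeff {f : ℂ → ℂ} {ρ M : ℝ} (hρ : 1 < ρ)
    (hd : ∀ w : ℂ, 1 ≤ ‖w‖ → ‖w‖ ≤ ρ → DifferentiableAt ℂ f (joukowski w))
    (hM : ∀ w : ℂ, ‖w‖ = ρ → ‖f (joukowski w)‖ ≤ M) {x : ℝ} (hx : x ∈ Set.Icc (-1 : ℝ) 1) :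
    HasSum (fun n : ℤ => chebyshevCoeff f n * ((Chebyshev.T ℝ n).eval x : ℝ)) (f x) := by
  have : Fact (0 < 2 * Real.pi) := ⟨Real.two_pi_pos⟩
  have hnorm : ∀ y : AddCircle (2 * Real.pi), ‖(fourier 1 y : ℂ)‖ = 1 := fun y => by
    rw [fourier_apply]; exact Circle.norm_coe _
  let F : C(AddCircle (2 * Real.pi), ℂ) :=
    ⟨fun y => f (joukowski (fourier 1 y)), continuous_iff_continuousAt.mpr fun y => by
      have h0 : (fourier 1 y : ℂ) ≠ 0 := by
        rw [← norm_ne_zero_iff, hnorm]; exact one_ne_zero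
      exact ((hd _ (hnorm y).ge ((hnorm y).trans_le hρ.le)).continuousAt.comp
        (differentiableAt_joukowski h0).continuousAt).comp (map_continuous (fourier 1)).continuousAt⟩
  have hfour : ∀ (n : ℤ) (θ : ℝ), (fourier n (θ : AddCircle (2 * Real.pi)) : ℂ) =
      Complex.exp (n * θ * Complex.I) := by
    intro n θ
    rw [fourier_coe_apply]
    congr 1
    push_cast
    field_simp
  have hF : ∀ θ : ℝ, F (θ : AddCircle (2 * Real.pi)) = f (Complex.cos θ) := by
    intro θ
    change f (joukowski (fourier 1 (θ : AddCircle (2 * Real.pi)))) = _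
    rw [hfour, Int.cast_one, one_mul, joukowski_exp]
  have hcoeff : ∀ n, fourierCoeff F n = chebyshevCoeff f n := by
    intro n
    rw [fourierCoeff_eq_intervalIntegral _ n 0, zero_add, chebyshevCoeff]
    simp only [hF, hfour, smul_eq_mul, one_div, Complex.real_smul]
    push_cast
    rfl
  have hsum : Summable (fourierCoeff F) := by
    rw [funext hcoeff]
    exact (summable_chebyshevCoeff hρ hd hM).of_norm
  have hser : ∀ θ : ℝ, HasSum (fun n : ℤ => chebyshevCoeff f n * Complex.exp (n * θ * Complex.I))
      (f (Complex.cos θ)) := by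
    intro θ
    have := has_pointwise_sum_fourier_series_of_summable hsum (θ : AddCircle (2 * Real.pi))
    simpa only [hcoeff, hfour, hF, smul_eq_mul] using this
  have h := ((hser (Real.arccos x)).add (hser (-Real.arccos x))).mul_left (1 / 2)
  have hcos : Complex.cos (Real.arccos x) = x := by
    rw [← Complex.ofReal_cos, Real.cos_arccos hx.1 hx.2]
  rw [Complex.ofReal_neg, Complex.cos_neg, hcos] at h
  have hfun : ∀ n : ℤ, chebyshevCoeff f n * ((Chebyshev.T ℝ n).eval x : ℝ) =
      1 / 2 * (chebyshevCoeff f n * Complex.exp (n * Real.arccos x * Complex.I) +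
        chebyshevCoeff f n * Complex.exp (n * -Real.arccos x * Complex.I)) := by
    intro n
    have hT : (((Chebyshev.T ℝ n).eval x : ℝ) : ℂ) = Complex.cos (n * Real.arccos x) := by
      conv_lhs => rw [← Real.cos_arccos hx.1 hx.2]
      rw [Chebyshev.T_real_cos]; push_cast; rfl
    rw [hT, Complex.cos, mul_neg, neg_mul]
    ring
  rw [← two_mul, ← mul_assoc, one_div_mul_cancel two_ne_zero, one_mul] at h
  simpa only [hfun] using h

/-! ### The error bound for analytic integrands -/

/-- The quadrature error may be computed termwise on the Chebyshev expansion. -/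
theorem hasSum_gaussLegendreError {f : ℂ → ℂ} {ρ M : ℝ} (hρ : 1 < ρ)
    (hd : ∀ w : ℂ, 1 ≤ ‖w‖ → ‖w‖ ≤ ρ → DifferentiableAt ℂ f (joukowski w))
    (hM : ∀ w : ℂ, ‖w‖ = ρ → ‖f (joukowski w)‖ ≤ M) (N : ℕ) :
    HasSum (fun n : ℤ => chebyshevCoeff f n * (gaussLegendreError N (Chebyshev.T ℝ n) : ℂ))
      ((∫ x in (-1 : ℝ)..1, f x) - gaussLegendreQuadrature N fun x => f x) := by
  have hle : (-1 : ℝ) ≤ 1 := by norm_num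
  have hsub : Set.uIoc (-1 : ℝ) 1 ⊆ Set.Icc (-1) 1 := by
    rw [Set.uIoc_of_le hle]; exact Set.Ioc_subset_Icc_self
  have hint : HasSum (fun n : ℤ => ∫ x in (-1 : ℝ)..1,
      chebyshevCoeff f n * ((Chebyshev.T ℝ n).eval x : ℝ)) (∫ x in (-1 : ℝ)..1, f x) := by
    refine intervalIntegral.hasSum_integral_of_dominated_convergence
      (fun n _ => ‖chebyshevCoeff f n‖) (fun n => ?_) (fun n => ?_) ?_ ?_ ?_
    · exact (Continuous.aestronglyMeasurable (by fun_prop))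
    · refine Filter.Eventually.of_forall fun x hx => ?_
      rw [norm_mul, Complex.norm_real, Real.norm_eq_abs]
      exact mul_le_of_le_one_right (norm_nonneg _)
        (Chebyshev.abs_eval_T_real_le_one n (abs_le.mpr (hsub hx)))
    · exact Filter.Eventually.of_forall fun _ _ => summable_chebyshevCoeff hρ hd hM
    · exact intervalIntegrable_const
    · exact Filter.Eventually.of_forall fun x hx => hasSum_chebyshevCoeff hρ hd hM (hsub hx)
  have hquad : HasSum (fun n : ℤ => ∑ t ∈ gaussLegendreNodes N, (gaussLegendreWeight N t : ℂ) *
      (chebyshevCoeff f n * ((Chebyshev.T ℝ n).eval t : ℝ)))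
      (gaussLegendreQuadrature N fun x => f x) :=
    hasSum_sum fun t ht =>
      (hasSum_chebyshevCoeff hρ hd hM (gaussLegendreNodes_subset_Icc ht)).mul_left _
  refine (hint.sub hquad).congr_fun ?_
  intro n
  rw [intervalIntegral.integral_const_mul, intervalIntegral.integral_ofReal, gaussLegendreError]
  push_cast
  rw [mul_sub, Finset.mul_sum]
  congr 1
  exact Finset.sum_congr rfl fun t _ => by ring

/-- If `f` is analytic on the closed Bernstein ellipse with parameter `ρ` and bounded by `M` on its
boundary, only the Chebyshev terms of even degree `n ≥ 2 * N` contribute to the error, each at most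
`2 * M * ρ⁻¹ ^ n * (32 / 15)`; these bounds sum to a geometric series. -/
theorem norm_integral_sub_gaussLegendreQuadrature_le {f : ℂ → ℂ} {ρ M : ℝ} (hρ : 1 < ρ)
    (hd : ∀ w : ℂ, 1 ≤ ‖w‖ → ‖w‖ ≤ ρ → DifferentiableAt ℂ f (joukowski w))
    (hM : ∀ w : ℂ, ‖w‖ = ρ → ‖f (joukowski w)‖ ≤ M) {N : ℕ} (hN : 2 ≤ N) :
    ‖(∫ x in (-1 : ℝ)..1, f x) - gaussLegendreQuadrature N fun x => f x‖ ≤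
      64 / 15 * M * (ρ⁻¹ ^ (2 * N) * (1 - ρ⁻¹ ^ 2)⁻¹) := by
  have hN0 : 0 < N := by omega
  have h := (hasSum_gaussLegendreError hρ hd hM N).nat_add_neg
  have hzero : gaussLegendreError N (Chebyshev.T ℝ 0) = 0 :=
    gaussLegendreError_chebyshevT_of_lt (n := 0) (by omega)
  simp only [hzero, Chebyshev.T_neg, Complex.ofReal_zero, mul_zero, add_zero] at h
  have hinj : Function.Injective fun j : ℕ => 2 * (N + j) := fun a b hab => by
    simp only at hab; omega
  have hr1 : ρ⁻¹ ^ 2 < 1 :=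
    pow_lt_one₀ (by positivity) (inv_lt_one_of_one_lt₀ hρ) two_ne_zero
  have hgeo : HasSum (fun j : ℕ => 64 / 15 * M * ρ⁻¹ ^ (2 * (N + j)))
      (64 / 15 * M * (ρ⁻¹ ^ (2 * N) * (1 - ρ⁻¹ ^ 2)⁻¹)) := by
    have := ((hasSum_geometric_of_lt_one (by positivity) hr1).mul_left
      (ρ⁻¹ ^ (2 * N))).mul_left (64 / 15 * M)
    simpa only [← pow_mul, ← pow_add, ← mul_add] using this
  have hM0 : 0 ≤ M := (norm_nonneg _).trans (hM ρ (by simp; linarith))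
  -- Terms of index outside `{2 * (N + j)}` vanish: the degree is below `2 * N` or odd.
  rw [← hinj.hasSum_iff] at h
  · refine h.norm_le_of_bounded hgeo fun j => ?_
    set n := 2 * (N + j) with hn
    have hE := abs_gaussLegendreError_chebyshevT_le (n := n) hN0 (by omega) (even_two_mul _)
    have hc1 : ‖chebyshevCoeff f n‖ ≤ M * ρ⁻¹ ^ n := by
      simpa using norm_chebyshevCoeff_le hρ.le hd hM n
    simp only [Function.comp_apply, ← hn, chebyshevCoeff_neg]
    rw [← two_mul, norm_mul, norm_mul, Complex.norm_real, Real.norm_eq_abs]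
    calc ‖(2 : ℂ)‖ * (‖chebyshevCoeff f n‖ * |gaussLegendreError N (Chebyshev.T ℝ n)|)
        ≤ 2 * (M * ρ⁻¹ ^ n * (32 / 15)) := by
          rw [Complex.norm_ofNat]
          gcongr
      _ = 64 / 15 * M * ρ⁻¹ ^ n := by ring
  · intro n hn
    have hE : gaussLegendreError N (Chebyshev.T ℝ n) = 0 := by
      rcases Nat.even_or_odd n with he | ho
      · apply gaussLegendreError_chebyshevT_of_lt
        by_contra! hlt
        obtain ⟨k, hk⟩ := he
        exact hn ⟨k - N, by simp only; omega⟩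
      · exact gaussLegendreError_chebyshevT_of_odd N ho
    simp [hE]

/-! ### The integrand `g_α(z, ·)` on the ellipse -/

theorem joukowski_im_le {w : ℂ} {ρ : ℝ} (h1 : 1 ≤ ‖w‖) (h2 : ‖w‖ ≤ ρ) :
    |(joukowski w).im| ≤ (ρ - ρ⁻¹) / 2 := by
  have hw : 0 < ‖w‖ := by linarith
  have him : (joukowski w).im = w.im / ‖w‖ * ((‖w‖ - ‖w‖⁻¹) / 2) := by
    have h3 : (joukowski w).im = (w + w⁻¹).im / 2 := by
      rw [joukowski]; exact Complex.div_ofNat_im _ 2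
    rw [h3, Complex.add_im, Complex.inv_im, Complex.normSq_eq_norm_sq]
    field_simp
    ring
  have hinv : ‖w‖⁻¹ ≤ 1 := inv_le_one_of_one_le₀ h1
  have hinv' : ρ⁻¹ ≤ ‖w‖⁻¹ := inv_anti₀ hw h2
  rw [him, abs_mul, abs_div, abs_of_pos hw, abs_of_nonneg (by linarith : 0 ≤ (‖w‖ - ‖w‖⁻¹) / 2)]
  calc |w.im| / ‖w‖ * ((‖w‖ - ‖w‖⁻¹) / 2) ≤ 1 * ((‖w‖ - ‖w‖⁻¹) / 2) := by
        gcongr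
        · linarith
        · exact (div_le_one hw).mpr (Complex.abs_im_le_norm w)
    _ ≤ (ρ - ρ⁻¹) / 2 := by linarith

/-- `ρ` is chosen so that the ellipse has semi-minor axis `|Re z| / α - δ`. -/
theorem rhoParam_sub_inv (z : ℂ) (α δ : ℝ) :
    (rhoParam z α δ - (rhoParam z α δ)⁻¹) / 2 = |z.re| / α - δ := by
  set c := |z.re| / α - δ with hc
  have hs : Real.sqrt (c ^ 2 + 1) ^ 2 = c ^ 2 + 1 := Real.sq_sqrt (by positivity)
  have hinv : (rhoParam z α δ)⁻¹ = Real.sqrt (c ^ 2 + 1) - c := by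
    apply inv_eq_of_mul_eq_one_right
    rw [rhoParam, ← hc]
    linear_combination hs
  rw [hinv, rhoParam, ← hc]
  ring

theorem one_lt_rhoParam {z : ℂ} {α δ : ℝ} (h : δ < |z.re| / α) : 1 < rhoParam z α δ := by
  have hs : 1 ≤ Real.sqrt ((|z.re| / α - δ) ^ 2 + 1) :=
    Real.one_le_sqrt.mpr (by linarith [sq_nonneg (|z.re| / α - δ)])
  rw [rhoParam]
  linarith

/-- The distance from `iαζ` to `z` is at least the difference of their real parts. -/
theorem le_norm_I_mul_sub {z : ℂ} (hz : z.re < 0) {α δ : ℝ} (hα : 0 < α) {ζ : ℂ}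
    (hζ : |ζ.im| ≤ |z.re| / α - δ) : α * δ ≤ ‖Complex.I * α * ζ - z‖ := by
  have h1 : (Complex.I * α * ζ - z).re = -(α * ζ.im) - z.re := by simp
  have h2 : α * ζ.im ≤ |z.re| - α * δ := by
    calc α * ζ.im ≤ α * (|z.re| / α - δ) := by gcongr; exact (le_abs_self _).trans hζ
      _ = |z.re| - α * δ := by field_simp
  have h3 := (le_abs_self _).trans (Complex.abs_re_le_norm (Complex.I * α * ζ - z))
  rw [h1] at h3
  rw [abs_of_neg hz] at h2
  linarith

theorem theorem3 (z : ℂ) (hz : z.re < 0) (α : ℝ) (hα : |z.im| < α)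
    (δ : ℝ) (hδ : 0 < δ) (hδ' : δ < |z.re| / α) (N : ℕ) (hN : 2 ≤ N) :
    ‖JInt α z - JApprox α N z‖ ≤
      32 * Real.exp |z.re| / (15 * Real.pi * δ) *
        (rhoParam z α δ ^ (-2 * ((N : ℤ) - 1)) / (rhoParam z α δ ^ 2 - 1)) := by
  have hα0 : 0 < α := (abs_nonneg _).trans_lt hα
  have hρ := one_lt_rhoParam hδ'
  set ρ := rhoParam z α δ with hρdef
  have hρ0 : 0 < ρ := by linarith
  let f : ℂ → ℂ := fun ζ => (α / (2 * Real.pi) : ℂ) *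
    (Complex.exp (Complex.I * α * ζ) / (Complex.I * α * ζ - z))
  have him : ∀ w : ℂ, 1 ≤ ‖w‖ → ‖w‖ ≤ ρ → |(joukowski w).im| ≤ |z.re| / α - δ :=
    fun w h1 h2 => (joukowski_im_le h1 h2).trans_eq (rhoParam_sub_inv z α δ)
  have hd : ∀ w : ℂ, 1 ≤ ‖w‖ → ‖w‖ ≤ ρ → DifferentiableAt ℂ f (joukowski w) := by
    intro w h1 h2
    have hne : Complex.I * α * joukowski w - z ≠ 0 :=
      norm_pos_iff.mp ((mul_pos hα0 hδ).trans_le (le_norm_I_mul_sub hz hα0 (him w h1 h2)))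
    simp only [f]
    fun_prop (disch := exact hne)
  have hM : ∀ w : ℂ, ‖w‖ = ρ → ‖f (joukowski w)‖ ≤ Real.exp |z.re| / (2 * Real.pi * δ) := by
    intro w hw
    have hi := him w (hw ▸ hρ.le) hw.le
    have hden := le_norm_I_mul_sub hz hα0 hi
    have hexp : ‖Complex.exp (Complex.I * α * joukowski w)‖ ≤ Real.exp |z.re| := by
      rw [Complex.norm_exp, Real.exp_le_exp]
      have h1 : (Complex.I * α * joukowski w).re = α * -(joukowski w).im := by simp
      rw [h1]
      calc α * -(joukowski w).im ≤ α * (|z.re| / α) := by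
            gcongr
            linarith [neg_le_abs (joukowski w).im]
        _ = |z.re| := by field_simp
    have hc : ‖(α / (2 * Real.pi) : ℂ)‖ = α / (2 * Real.pi) := by
      rw [show (α / (2 * Real.pi) : ℂ) = ((α / (2 * Real.pi) : ℝ) : ℂ) by push_cast; rfl,
        Complex.norm_real, Real.norm_of_nonneg (by positivity)]
    simp only [f]
    rw [norm_mul, hc, norm_div]
    calc α / (2 * Real.pi) * (‖Complex.exp (Complex.I * α * joukowski w)‖ /
          ‖Complex.I * α * joukowski w - z‖)
        ≤ α / (2 * Real.pi) * (Real.exp |z.re| / (α * δ)) := by gcongr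
      _ = Real.exp |z.re| / (2 * Real.pi * δ) := by field_simp
  have hJ : JInt α z = ∫ x in (-1 : ℝ)..1, f x := by
    rw [JInt, ← intervalIntegral.integral_const_mul]
  have hQ : JApprox α N z = gaussLegendreQuadrature N fun x => f x := rfl
  rw [hJ, hQ]
  refine (norm_integral_sub_gaussLegendreQuadrature_le hρ hd hM hN).trans_eq ?_
  have hpow : ρ ^ (-2 * ((N : ℤ) - 1)) = ρ⁻¹ ^ (2 * N) * ρ ^ 2 := by
    rw [show -2 * ((N : ℤ) - 1) = -((2 * N : ℕ) : ℤ) + (2 : ℕ) by push_cast; ring,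
      zpow_add₀ hρ0.ne', zpow_neg, zpow_natCast, zpow_natCast, inv_pow]
  have h1 : ρ ^ 2 - 1 ≠ 0 := by nlinarith
  have h2 : 1 - ρ⁻¹ ^ 2 = (ρ ^ 2 - 1) / ρ ^ 2 := by field_simp
  rw [hpow, h2, inv_div]
  field_simp
  ring
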